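/- Let $m,n\in\mathbb N$ with $m>1$. Let $h_1,\dots,h_n:\mathbb R\to[0,\infty)$ be arbitrary measurable functions and, for $i=1,\dots,n$, let $$F_i=\begin{pmatrix}A_i&B_i\\-B_i&A_i\end{pmatrix}\in\mathbb R^{2m\times 2m},$$ where $A_i\in\mathbb R^{m\times m}$ is an arbitrary symmetric matrix and $B_i\in\mathbb R^{m\times m}$ is an arbitrary antisymmetric matrix. Let $X=(X_1,\dots,X_m)$ and $Y=(Y_1,\dots,Y_m)$ be random vectors in $\mathbb R^m$, defined on a common probability space, such that $(X,Y)$ has a joint density with respect to Lebesgue measure on $\mathbb R^m\times\mathbb R^m$ of the form $$f_{X,Y}(x,y)=K\prod_{i=1}^n h_i\!\left(\begin{pmatrix}x^\top & y^\top\end{pmatrix}F_i\begin{pmatrix}x\\y\end{pmatrix}\right),$$ where $K$ is the normalizing constant. Then for every deterministic $w=(w_1,\dots,w_m)\in\mathbb R^m$ with $w_j\ge 0$ for all $j$ and $\sum_{j=1}^m w_j=1$, the random variable $$Z=\sum_{j=1}^m w_j\frac{X_j}{Y_j}$$ has the standard Cauchy distribution, i.e. the distribution on $\mathbb R$ with density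 $z\mapsto\frac{1}{\pi(1+z^2)}$. Furthermore, for every $1\le j\le m$, the ratio $X_j/Y_j$ also has the standard Cauchy distribution. -/

import Mathlib

open MeasureTheory ProbabilityTheory Matrix

/-- A real `2m × 2m` matrix, indexed by two blocks of size `m`, has the form
`[[A, B], [-B, A]]` with `A` symmetric and `B` antisymmetric. -/
def IsSymmAntisymmBlock {m : ℕ} (F : Matrix (Fin m ⊕ Fin m) (Fin m ⊕ Fin m) ℝ) : Prop :=
  ∃ A B : Matrix (Fin m) (Fin m) ℝ,
    Aᵀ = A ∧ Bᵀ = -B ∧ F = Matrix.fromBlocks A B (-B) A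

/-- The quadratic form `(xᵀ, yᵀ) F (x, y)` at a pair `p = (x, y)` of vectors of length `m`. -/
def blockQuadForm {m : ℕ} (F : Matrix (Fin m ⊕ Fin m) (Fin m ⊕ Fin m) ℝ)
    (p : (Fin m → ℝ) × (Fin m → ℝ)) : ℝ :=
  Sum.elim p.1 p.2 ⬝ᵥ (F *ᵥ Sum.elim p.1 p.2)

/-! Put `z j = x j + i y j`. Each block form is Hermitian in `z`, with matrix `A - iB`, so the
density is invariant under `z ↦ e^{iθ} z`, and the law of the weighted ratio may be averaged over
`θ`. For a fixed point with all `z j ≠ 0`, the rotated ratios are `cot (θ + arg (z j))`, and `i cot`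
is the boundary value at `u = e^{iθ}` of the Cayley transform `(1 + a u²) / (1 - a u²)`, `a = z j /
conj (z j)`. These have nonnegative real part on the disc, so for `t ≥ 0` the function `exp (-t ∑ w
j (...))` is holomorphic there and bounded by 1; its circle mean is its value `e^{-t}` at `0`,
whatever the point (`integral_exp_neg_sum_cayley`). This gives the characteristic function at `-t`;
conjugation gives the other half-line. -/

/-! ### Cayley transforms on the disc and its boundary -/

theorem ae_mul_exp_two_mul_ne_one {a : ℂ} (ha : ‖a‖ = 1) :
    ∀ᵐ θ : ℝ, a * Complex.exp (θ * Complex.I) ^ 2 ≠ 1 := by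
  have ha' : a = Complex.exp (a.arg * Complex.I) := by
    conv_lhs => rw [← Complex.norm_mul_exp_arg_mul_I a, ha]
    simp
  have hsub : {θ : ℝ | ¬ a * Complex.exp (θ * Complex.I) ^ 2 ≠ 1} ⊆
      Set.range (fun n : ℤ => (n * (2 * Real.pi) - a.arg) / 2) := by
    intro θ hθ
    simp only [ne_eq, not_not, Set.mem_ofPred_eq] at hθ
    rw [ha', ← Complex.exp_nat_mul, ← Complex.exp_add, Complex.exp_eq_one_iff] at hθ
    obtain ⟨k, hk⟩ := hθ
    refine ⟨k, ?_⟩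
    have h2 := congrArg Complex.im hk
    simp at h2
    simp only
    linarith
  exact ((Set.countable_range _).mono hsub).measure_zero _

/-- The real part is `(1 - |v|²) / |1 - v|²`; at `v = 1` division by zero gives `0`. -/
theorem re_cayley_nonneg {v : ℂ} (hv : ‖v‖ ≤ 1) : 0 ≤ ((1 + v) / (1 - v)).re := by
  have h1 : v.re * v.re + v.im * v.im ≤ 1 := by
    rw [← Complex.normSq_apply, Complex.normSq_eq_norm_sq]
    nlinarith [norm_nonneg v]
  rw [Complex.div_re, ← add_div]
  refine div_nonneg ?_ (Complex.normSq_nonneg _)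
  simp
  nlinarith

theorem norm_exp_neg_sum_cayley_le_one {ι : Type*} [Fintype ι] {w : ι → ℝ} (hw : ∀ j, 0 ≤ w j)
    {v : ι → ℂ} (hv : ∀ j, ‖v j‖ ≤ 1) {t : ℝ} (ht : 0 ≤ t) :
    ‖Complex.exp (-t * ∑ j, w j * ((1 + v j) / (1 - v j)))‖ ≤ 1 := by
  rw [Complex.norm_exp, Real.exp_le_one_iff]
  have h : 0 ≤ (∑ j, w j * ((1 + v j) / (1 - v j)) : ℂ).re := by
    rw [Complex.re_sum]
    refine Finset.sum_nonneg fun j _ => ?_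
    rw [Complex.re_ofReal_mul]
    exact mul_nonneg (hw j) (re_cayley_nonneg (hv j))
  rw [← Complex.ofReal_neg, Complex.re_ofReal_mul]
  nlinarith

theorem continuousAt_exp_neg_sum_cayley {ι : Type*} [Fintype ι] (w : ι → ℝ) (a : ι → ℂ) (t : ℝ)
    {z : ℂ} (hz : ∀ j, a j * z ^ 2 ≠ 1) :
    ContinuousAt (fun u : ℂ =>
      Complex.exp (-t * ∑ j, w j * ((1 + a j * u ^ 2) / (1 - a j * u ^ 2)))) z := by
  have h : ∀ j, 1 - a j * z ^ 2 ≠ 0 := fun j => sub_ne_zero.2 (hz j).symm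
  refine Complex.continuous_exp.continuousAt.comp ?_
  refine continuousAt_const.mul (tendsto_finsetSum _ fun j _ => ?_)
  exact continuousAt_const.mul (ContinuousAt.div (by fun_prop) (by fun_prop) (h j))

open Filter Topology in
/-- The boundary mean of a bounded holomorphic function built from Cayley transforms equals its
value at the centre of the disc. -/
theorem integral_exp_neg_sum_cayley {ι : Type*} [Fintype ι] {w : ι → ℝ} (hw : ∀ j, 0 ≤ w j)
    (hw1 : ∑ j, w j = 1) {a : ι → ℂ} (ha : ∀ j, ‖a j‖ = 1) {t : ℝ} (ht : 0 ≤ t) :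
    ∫ θ in (0 : ℝ)..2 * Real.pi, Complex.exp (-t * ∑ j, w j *
      ((1 + a j * Complex.exp (θ * Complex.I) ^ 2) /
        (1 - a j * Complex.exp (θ * Complex.I) ^ 2))) = 2 * Real.pi * Complex.exp (-t) := by
  set G : ℂ → ℂ := fun u =>
    Complex.exp (-t * ∑ j, w j * ((1 + a j * u ^ 2) / (1 - a j * u ^ 2))) with hG
  have hlt : ∀ u : ℂ, ‖u‖ < 1 → ∀ j, ‖a j * u ^ 2‖ < 1 := fun u hu j => by
    rw [norm_mul, ha, one_mul, norm_pow]
    exact pow_lt_one₀ (norm_nonneg _) hu two_ne_zero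
  have hne : ∀ u : ℂ, ‖u‖ < 1 → ∀ j, 1 - a j * u ^ 2 ≠ 0 := fun u hu j h => by
    have := hlt u hu j
    rw [← sub_eq_zero.1 h] at this
    simp at this
  have hdiff : ∀ u : ℂ, ‖u‖ < 1 → DifferentiableAt ℂ G u := fun u hu => by
    refine DifferentiableAt.cexp ?_
    refine (DifferentiableAt.fun_sum fun j _ => ?_).const_mul _
    have hsq : DifferentiableAt ℂ (fun u : ℂ => a j * u ^ 2) u := by fun_prop
    exact ((hsq.const_add 1).fun_div (hsq.const_sub 1) (hne u hu j)).const_mul _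
  have hG0 : G 0 = Complex.exp (-t) := by
    simp [hG, ← Complex.ofReal_sum, hw1]
  have hmean : ∀ r ∈ Set.Ioo (0 : ℝ) 1,
      ∫ θ in (0 : ℝ)..2 * Real.pi, G (circleMap 0 r θ) = 2 * Real.pi * Complex.exp (-t) := by
    intro r hr
    have hlt1 : ∀ z ∈ Metric.closedBall (0 : ℂ) |r|, ‖z‖ < 1 := fun z hz => by
      rw [mem_closedBall_zero_iff, abs_of_pos hr.1] at hz
      exact hz.trans_lt hr.2
    have h := circleAverage_of_differentiable_on_off_countable (f := G) (c := 0) (R := r)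
      Set.countable_empty
      (fun z hz => (hdiff z (hlt1 z hz)).continuousAt.continuousWithinAt)
      (fun z hz => hdiff z (hlt1 z (Metric.ball_subset_closedBall hz.1)))
    rw [Real.circleAverage_def, hG0] at h
    rw [← h, Complex.real_smul]
    have : (Real.pi : ℂ) ≠ 0 := by exact_mod_cast Real.pi_ne_zero
    push_cast
    field_simp
  have hIoo : Set.Ioo (0 : ℝ) 1 ∈ 𝓝[<] (1 : ℝ) := Ioo_mem_nhdsLT one_pos
  have hlim : Tendsto (fun r : ℝ => ∫ θ in (0 : ℝ)..2 * Real.pi, G (circleMap 0 r θ)) (𝓝[<] 1)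
      (𝓝 (∫ θ in (0 : ℝ)..2 * Real.pi, G (circleMap 0 1 θ))) := by
    refine intervalIntegral.tendsto_integral_filter_of_dominated_convergence (fun _ => 1) ?_ ?_ ?_ ?_
    · filter_upwards [hIoo] with r hr
      refine Continuous.aestronglyMeasurable ?_
      refine continuous_iff_continuousAt.2 fun θ => ?_
      have hθ : ‖circleMap 0 r θ‖ < 1 := by simpa [abs_of_pos hr.1] using hr.2
      exact (hdiff _ hθ).continuousAt.comp (f := circleMap 0 r)
        (continuous_circleMap 0 r).continuousAt
    · filter_upwards [hIoo] with r hr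
      refine Eventually.of_forall fun θ _ => ?_
      refine norm_exp_neg_sum_cayley_le_one hw (fun j => (hlt _ ?_ j).le) ht
      simpa [abs_of_pos hr.1] using hr.2
    · exact intervalIntegrable_const
    -- Radial limits exist off the countably many angles where some denominator vanishes.
    · have := ae_all_iff.2 fun j => ae_mul_exp_two_mul_ne_one (ha j)
      filter_upwards [this] with θ hθ _
      have hcont : ContinuousAt G (circleMap 0 1 θ) :=
        continuousAt_exp_neg_sum_cayley w a t (by simpa [circleMap] using hθ)
      refine (hcont.tendsto.comp ?_).mono_left nhdsWithin_le_nhds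
      have : Continuous fun r : ℝ => circleMap 0 r θ := by unfold circleMap; fun_prop
      exact this.tendsto 1
  have hconst : Tendsto (fun r : ℝ => ∫ θ in (0 : ℝ)..2 * Real.pi, G (circleMap 0 r θ)) (𝓝[<] 1)
      (𝓝 (2 * Real.pi * Complex.exp (-t))) := by
    refine tendsto_const_nhds.congr' ?_
    filter_upwards [hIoo] with r hr using (hmean r hr).symm
  have h := tendsto_nhds_unique hlim hconst
  simpa [circleMap, hG] using h

/-- Multiply through by `conj z`. For real `z` both sides are `0` by the convention for division by
zero, so no angle is exceptional. -/
theorem cayley_div_conj {z : ℂ} (hz : z ≠ 0) :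
    (1 + z / (starRingEnd ℂ) z) / (1 - z / (starRingEnd ℂ) z) =
      Complex.I * ((z.re / z.im : ℝ) : ℂ) := by
  have hz' : (starRingEnd ℂ) z ≠ 0 := by simpa using hz
  have h1 : (1 + z / (starRingEnd ℂ) z) / (1 - z / (starRingEnd ℂ) z) =
      (z + (starRingEnd ℂ) z) / ((starRingEnd ℂ) z - z) := by
    rw [one_add_div hz', one_sub_div hz', div_div_div_cancel_right₀ hz', add_comm]
  rw [h1, Complex.add_conj, ← neg_sub, Complex.sub_conj]
  rcases eq_or_ne z.im 0 with h | h
  · simp [h]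
  · have : (z.im : ℂ) ≠ 0 := by exact_mod_cast h
    push_cast
    field_simp
    simp

theorem cayley_rotation {x y : ℝ} (hxy : (x, y) ≠ 0) (θ : ℝ) :
    ((1 + ((⟨x, y⟩ : ℂ) / ⟨x, -y⟩) * Complex.exp (θ * Complex.I) ^ 2) /
        (1 - ((⟨x, y⟩ : ℂ) / ⟨x, -y⟩) * Complex.exp (θ * Complex.I) ^ 2)) =
      Complex.I * (((Real.cos θ * x - Real.sin θ * y) /
        (Real.sin θ * x + Real.cos θ * y) : ℝ) : ℂ) := by
  set e := Complex.exp (θ * Complex.I) with he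
  have hee : e * (starRingEnd ℂ) e = 1 := by
    rw [Complex.mul_conj, Complex.normSq_eq_norm_sq, he, Complex.norm_exp_ofReal_mul_I]; simp
  have hz : (⟨x, y⟩ : ℂ) ≠ 0 := fun h => hxy (by
    rw [Complex.ext_iff] at h
    exact Prod.ext h.1 h.2)
  have hcz : (⟨x, -y⟩ : ℂ) = (starRingEnd ℂ) ⟨x, y⟩ := rfl
  have he0 : e ≠ 0 := Complex.exp_ne_zero _
  have hcz0 : (starRingEnd ℂ) (⟨x, y⟩ : ℂ) ≠ 0 := by simpa using hz
  have hce0 : (starRingEnd ℂ) e ≠ 0 := by simpa using he0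
  have h := cayley_div_conj (mul_ne_zero he0 hz)
  have hre : (e * ⟨x, y⟩).re = Real.cos θ * x - Real.sin θ * y := by
    simp [he, Complex.exp_ofReal_mul_I_re, Complex.exp_ofReal_mul_I_im]
  have him : (e * ⟨x, y⟩).im = Real.sin θ * x + Real.cos θ * y := by
    simp [he, Complex.exp_ofReal_mul_I_re, Complex.exp_ofReal_mul_I_im]; ring
  have hv : e * ⟨x, y⟩ / (starRingEnd ℂ) (e * ⟨x, y⟩) = ((⟨x, y⟩ : ℂ) / ⟨x, -y⟩) * e ^ 2 := by
    rw [map_mul, hcz]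
    field_simp
    linear_combination (-1 : ℂ) * hee
  rw [hre, him, hv] at h
  exact h

/-- The average over a uniformly random common rotation angle of the characteristic function of a
convex combination of cotangents. -/
theorem integral_exp_sum_rotation {ι : Type*} [Fintype ι] {w : ι → ℝ} (hw : ∀ j, 0 ≤ w j)
    (hw1 : ∑ j, w j = 1) {x y : ι → ℝ} (hxy : ∀ j, (x j, y j) ≠ 0) {t : ℝ} (ht : 0 ≤ t) :
    ∫ θ in (0 : ℝ)..2 * Real.pi, Complex.exp (((-t : ℝ) : ℂ) *
      ((∑ j, w j * ((Real.cos θ * x j - Real.sin θ * y j) /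
        (Real.sin θ * x j + Real.cos θ * y j)) : ℝ) : ℂ) * Complex.I) =
      2 * Real.pi * Complex.exp (-t) := by
  have hnorm : ∀ j, ‖(⟨x j, y j⟩ : ℂ) / ⟨x j, -y j⟩‖ = 1 := fun j => by
    have hz : (⟨x j, y j⟩ : ℂ) ≠ 0 := fun h => hxy j (by
      rw [Complex.ext_iff] at h
      exact Prod.ext h.1 h.2)
    have hcz : (⟨x j, -y j⟩ : ℂ) = (starRingEnd ℂ) ⟨x j, y j⟩ := rfl
    rw [hcz, norm_div, RCLike.norm_conj, div_self (norm_ne_zero_iff.2 hz)]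
  rw [← integral_exp_neg_sum_cayley hw hw1 hnorm ht]
  refine intervalIntegral.integral_congr fun θ _ => ?_
  simp only [cayley_rotation (hxy _)]
  congr 1
  rw [Complex.ofReal_sum, mul_assoc, Finset.sum_mul, Complex.ofReal_neg]
  congr 1
  refine Finset.sum_congr rfl fun j _ => ?_
  push_cast
  ring

/-! ### Rotation invariance of the joint law -/

/-- The rotation by the angle `θ` in each of the coordinate planes `(x j, y j)`. -/
noncomputable def planeRotation {m : ℕ} (θ : ℝ) :
    (Fin m → ℝ) × (Fin m → ℝ) →ₗ[ℝ] (Fin m → ℝ) × (Fin m → ℝ) where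
  toFun p := (Real.cos θ • p.1 - Real.sin θ • p.2, Real.sin θ • p.1 + Real.cos θ • p.2)
  map_add' p q := by ext <;> simp <;> ring
  map_smul' c p := by ext <;> simp <;> ring

theorem planeRotation_apply {m : ℕ} (θ : ℝ) (p : (Fin m → ℝ) × (Fin m → ℝ)) :
    planeRotation θ p =
      (Real.cos θ • p.1 - Real.sin θ • p.2, Real.sin θ • p.1 + Real.cos θ • p.2) := rfl

theorem continuous_planeRotation {m : ℕ} (θ : ℝ) : Continuous (planeRotation (m := m) θ) :=
  (planeRotation θ).continuous_of_finiteDimensional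

/-- Conjugating a rotation by the reflection `(x, y) ↦ (x, -y)` inverts it. -/
theorem abs_det_planeRotation {m : ℕ} (θ : ℝ) :
    |LinearMap.det (planeRotation (m := m) θ)| = 1 := by
  let e : ((Fin m → ℝ) × (Fin m → ℝ)) ≃ₗ[ℝ] (Fin m → ℝ) × (Fin m → ℝ) :=
    (LinearEquiv.refl ℝ _).prodCongr (LinearEquiv.neg ℝ)
  have hconj := LinearMap.det_conj (planeRotation (m := m) θ) e
  have hmul : (planeRotation (m := m) θ) ∘ₗ
      ((e : _ →ₗ[ℝ] _) ∘ₗ planeRotation (m := m) θ ∘ₗ (e.symm : _ →ₗ[ℝ] _)) = LinearMap.id := by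
    refine LinearMap.ext fun p => ?_
    have he : ∀ q, e q = (q.1, -q.2) := fun _ => rfl
    have he' : ∀ q, e.symm q = (q.1, -q.2) := fun _ => rfl
    have hcs := Real.sin_sq_add_cos_sq θ
    simp only [LinearMap.comp_apply, LinearEquiv.coe_coe, he, he', planeRotation_apply,
      LinearMap.id_apply]
    ext i
    · simp
      linear_combination p.1 i * hcs
    · simp
      linear_combination p.2 i * hcs
  have hdet := congrArg LinearMap.det hmul
  rw [LinearMap.det_comp, hconj, LinearMap.det_id] at hdet
  rw [← sq_eq_sq₀ (abs_nonneg _) zero_le_one, sq_abs]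
  linarith

theorem measurePreserving_planeRotation {m : ℕ} (θ : ℝ) :
    MeasurePreserving (planeRotation (m := m) θ) volume volume := by
  refine ⟨(continuous_planeRotation θ).measurable, ?_⟩
  have habs := abs_det_planeRotation (m := m) θ
  have h0 : LinearMap.det (planeRotation (m := m) θ) ≠ 0 := fun h => by simp [h] at habs
  have : (volume : Measure ((Fin m → ℝ) × (Fin m → ℝ))).IsAddHaarMeasure :=
    Measure.prod.instIsAddHaarMeasure volume volume
  rw [Measure.map_linearMap_addHaar_eq_smul_addHaar _ h0, abs_inv, habs]
  simp

theorem blockQuadForm_planeRotation {m : ℕ} {F : Matrix (Fin m ⊕ Fin m) (Fin m ⊕ Fin m) ℝ}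
    (hF : IsSymmAntisymmBlock F) (θ : ℝ) (p : (Fin m → ℝ) × (Fin m → ℝ)) :
    blockQuadForm F (planeRotation θ p) = blockQuadForm F p := by
  obtain ⟨A, B, hA, hB, rfl⟩ := hF
  have hsymm : ∀ u v : Fin m → ℝ, u ⬝ᵥ A *ᵥ v = v ⬝ᵥ A *ᵥ u := fun u v => by
    rw [dotProduct_mulVec, ← mulVec_transpose, hA, dotProduct_comm]
  have hanti : ∀ u v : Fin m → ℝ, u ⬝ᵥ B *ᵥ v = -(v ⬝ᵥ B *ᵥ u) := fun u v => by
    rw [dotProduct_mulVec, ← mulVec_transpose, hB, dotProduct_comm, neg_mulVec, dotProduct_neg]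
  have hself : ∀ u : Fin m → ℝ, u ⬝ᵥ B *ᵥ u = 0 := fun u => by linarith [hanti u u]
  have hform : ∀ q : (Fin m → ℝ) × (Fin m → ℝ), blockQuadForm (fromBlocks A B (-B) A) q =
      q.1 ⬝ᵥ A *ᵥ q.1 + q.2 ⬝ᵥ A *ᵥ q.2 + 2 * (q.1 ⬝ᵥ B *ᵥ q.2) := fun q => by
    rw [blockQuadForm, fromBlocks_mulVec, sumElim_dotProduct_sumElim]
    simp only [Sum.elim_comp_inl, Sum.elim_comp_inr, dotProduct_add, neg_mulVec, dotProduct_neg]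
    rw [hanti q.2 q.1]
    ring
  rw [hform, hform, planeRotation_apply]
  simp only [mulVec_add, mulVec_sub, mulVec_smul, dotProduct_add, dotProduct_sub, add_dotProduct,
    sub_dotProduct, dotProduct_smul, smul_dotProduct, smul_eq_mul, hself]
  rw [hsymm p.2 p.1, hanti p.2 p.1]
  linear_combination (p.1 ⬝ᵥ A *ᵥ p.1 + p.2 ⬝ᵥ A *ᵥ p.2 + 2 * (p.1 ⬝ᵥ B *ᵥ p.2)) *
    Real.sin_sq_add_cos_sq θ

theorem continuous_blockQuadForm {m : ℕ} (F : Matrix (Fin m ⊕ Fin m) (Fin m ⊕ Fin m) ℝ) :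
    Continuous (blockQuadForm F) := by
  have h : Continuous fun p : (Fin m → ℝ) × (Fin m → ℝ) => Sum.elim p.1 p.2 := by
    refine continuous_pi fun i => ?_
    rcases i with i | i <;> simp only [Sum.elim_inl, Sum.elim_inr] <;> fun_prop
  exact h.dotProduct (continuous_const.matrix_mulVec h)

theorem MeasureTheory.MeasurePreserving.withDensity_of_comp_eq {α : Type*} [MeasurableSpace α]
    {μ : Measure α} {T : α → α} (hT : MeasurePreserving T μ μ) {f : α → ENNReal}
    (hf : Measurable f) (hfT : ∀ x, f (T x) = f x) :
    MeasurePreserving T (μ.withDensity f) (μ.withDensity f) := by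
  refine ⟨hT.measurable, Measure.ext fun s hs => ?_⟩
  rw [Measure.map_apply hT.measurable hs, withDensity_apply _ hs,
    withDensity_apply _ (hT.measurable hs), ← hT.setLIntegral_comp_preimage hs hf]
  simp only [hfT]

theorem ae_pair_ne_zero {m : ℕ} :
    ∀ᵐ p : (Fin m → ℝ) × (Fin m → ℝ), ∀ j, (p.1 j, p.2 j) ≠ 0 := by
  refine ae_all_iff.2 fun j => ?_
  have h : ∀ᵐ x : Fin m → ℝ, x j ≠ 0 := by
    have h0 : ∀ᵐ s : ℝ, s ≠ 0 := by simp [ae_iff]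
    exact (Measure.quasiMeasurePreserving_eval (fun _ : Fin m => (volume : Measure ℝ)) j).ae h0
  have h' : ∀ᵐ p : (Fin m → ℝ) × (Fin m → ℝ), p.1 j ≠ 0 :=
    Measure.quasiMeasurePreserving_fst.ae h
  filter_upwards [h'] with p hp hp0
  exact hp (congrArg Prod.fst hp0)

/-! ### Characteristic functions -/

theorem charFun_ratio_of_rotation_invariant {m : ℕ} {μ : Measure ((Fin m → ℝ) × (Fin m → ℝ))}
    [IsProbabilityMeasure μ] (hac : μ ≪ volume)
    (hrot : ∀ θ, MeasurePreserving (planeRotation θ) μ μ) {w : Fin m → ℝ} (hw : ∀ j, 0 ≤ w j)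
    (hw1 : ∑ j, w j = 1) {t : ℝ} (ht : 0 ≤ t) :
    charFun (μ.map fun p => ∑ j, w j * (p.1 j / p.2 j)) (-t) = Complex.exp (-t) := by
  set S : (Fin m → ℝ) × (Fin m → ℝ) → ℝ := fun p => ∑ j, w j * (p.1 j / p.2 j) with hS
  have hSm : Measurable S := by fun_prop
  set g : (Fin m → ℝ) × (Fin m → ℝ) → ℂ :=
    fun p => Complex.exp (((-t : ℝ) : ℂ) * (S p : ℂ) * Complex.I) with hg
  have hgm : Measurable g := by fun_prop
  have hgn : ∀ p, ‖g p‖ = 1 := fun p => by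
    rw [hg]
    simp only
    rw [← Complex.ofReal_mul, Complex.norm_exp_ofReal_mul_I]
  have hchar : charFun (μ.map S) (-t) = ∫ p, g p ∂μ := by
    rw [charFun_apply_real, integral_map hSm.aemeasurable (by fun_prop)]
  have hinv : ∀ θ, ∫ p, g (planeRotation θ p) ∂μ = ∫ p, g p ∂μ := fun θ => by
    conv_rhs => rw [← (hrot θ).map_eq]
    rw [integral_map (hrot θ).aemeasurable hgm.aestronglyMeasurable]
  have hjoint : Measurable fun q : ℝ × ((Fin m → ℝ) × (Fin m → ℝ)) =>
      planeRotation q.1 q.2 := by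
    simp only [planeRotation_apply]
    fun_prop
  have hswap : ∫ θ in (0 : ℝ)..2 * Real.pi, ∫ p, g (planeRotation θ p) ∂μ =
      ∫ p, (∫ θ in (0 : ℝ)..2 * Real.pi, g (planeRotation θ p)) ∂μ := by
    simp only [intervalIntegral.integral_of_le Real.two_pi_pos.le]
    refine integral_integral_swap ?_
    refine Integrable.of_bound (C := 1) (hgm.comp hjoint).aestronglyMeasurable ?_
    exact Filter.Eventually.of_forall fun q => (hgn _).le
  have hinner : ∀ᵐ p ∂μ, ∫ θ in (0 : ℝ)..2 * Real.pi, g (planeRotation θ p) =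
      2 * Real.pi * Complex.exp (-t) := by
    filter_upwards [hac.ae_le ae_pair_ne_zero] with p hp
    simpa [hg, hS, planeRotation_apply] using integral_exp_sum_rotation hw hw1 hp ht
  rw [integral_congr_ae hinner] at hswap
  simp only [hinv] at hswap
  simp only [intervalIntegral.integral_const, integral_const, probReal_univ, one_smul] at hswap
  rw [hchar]
  have hpi : (2 * Real.pi : ℂ) ≠ 0 := by
    exact_mod_cast (mul_ne_zero two_ne_zero Real.pi_ne_zero)
  refine mul_left_cancel₀ hpi ?_
  rw [← hswap, Complex.real_smul]
  push_cast
  ring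

/-- The circle mean also computes this one: rotating the single point `(0, 1)` gives the ratio `-tan
θ`, and `θ = arctan x` turns the uniform angle into the Cauchy density. -/
theorem charFun_cauchyMeasure_neg {t : ℝ} (ht : 0 ≤ t) :
    charFun (cauchyMeasure 0 1) (-t) = Complex.exp (-t) := by
  set f : ℝ → ℂ := fun x => Complex.exp (((-t : ℝ) : ℂ) * (x : ℂ) * Complex.I) with hf
  have himage : Real.arctan '' Set.univ = Set.Ioo (-(Real.pi / 2)) (Real.pi / 2) := by
    rw [Set.image_univ, Real.range_arctan]
  have hchange := integral_image_eq_integral_abs_deriv_smul MeasurableSet.univ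
    (fun x _ => (Real.hasDerivAt_arctan x).hasDerivWithinAt) Real.arctan_injective.injOn
    (fun θ => f (-Real.tan θ))
  rw [himage, ← integral_Ioc_eq_integral_Ioo,
    ← intervalIntegral.integral_of_le (by linarith [Real.pi_pos])] at hchange
  simp only [Real.tan_arctan, setIntegral_univ] at hchange
  have hper : Function.Periodic (fun θ => f (-Real.tan θ)) Real.pi := fun θ => by
    simp only [Real.tan_periodic θ]
  have hcirc : ∫ θ in (0 : ℝ)..2 * Real.pi, f (-Real.tan θ) = 2 * Real.pi * Complex.exp (-t) := by
    have h := integral_exp_sum_rotation (ι := Unit) (w := fun _ => 1) (x := fun _ => 0)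
      (y := fun _ => 1) (by simp) (by simp) (by simp) ht
    rw [← h]
    refine intervalIntegral.integral_congr fun θ _ => ?_
    simp [hf, Real.tan_eq_sin_div_cos, neg_div]
  have hmeas : Measurable fun θ : ℝ => f (-Real.tan θ) := by
    have : Measurable Real.tan := by
      simp only [funext Real.tan_eq_sin_div_cos]
      fun_prop
    fun_prop
  have hint : ∀ a b, IntervalIntegrable (fun θ : ℝ => f (-Real.tan θ)) volume a b := fun a b => by
    refine (intervalIntegrable_const (c := (1 : ℝ))).mono_fun hmeas.aestronglyMeasurable ?_
    refine Filter.Eventually.of_forall fun θ => ?_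
    simp only [hf]
    rw [← Complex.ofReal_mul, Complex.norm_exp_ofReal_mul_I]
    simp
  -- `tan` has period `π`, so the full circle covers the range of `arctan` twice.
  have hhalf : ∫ θ in (0 : ℝ)..2 * Real.pi, f (-Real.tan θ) =
      2 * ∫ θ in -(Real.pi / 2)..Real.pi / 2, f (-Real.tan θ) := by
    have h1 := hper.intervalIntegral_add_eq 0 (-(Real.pi / 2))
    have h2 := hper.intervalIntegral_add_eq Real.pi (-(Real.pi / 2))
    rw [show -(Real.pi / 2) + Real.pi = Real.pi / 2 by ring] at h1 h2
    rw [← intervalIntegral.integral_add_adjacent_intervals (hint 0 Real.pi) (hint _ _), ← h1,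
      two_mul]
    rw [zero_add] at h1 ⊢
    rw [two_mul, h2, h1]
  rw [hcirc, hchange] at hhalf
  have hneg : ∫ x : ℝ, |1 / (1 + x ^ 2)| • f (-x) = ∫ x : ℝ, |1 / (1 + x ^ 2)| • f x := by
    rw [← integral_neg_eq_self (fun x : ℝ => |1 / (1 + x ^ 2)| • f x)]
    simp
  rw [hneg] at hhalf
  have hpi : (Real.pi : ℂ) ≠ 0 := by exact_mod_cast Real.pi_ne_zero
  have hval : ∫ x : ℝ, |1 / (1 + x ^ 2)| • f x = Real.pi * Complex.exp (-t) := by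
    linear_combination (-1 / 2 : ℂ) * hhalf
  rw [charFun_apply_real, cauchyMeasure_of_scale_ne_zero 0 one_ne_zero,
    integral_withDensity_eq_integral_toReal_smul (measurable_cauchyPDF _ _)
      (ae_of_all _ fun _ => ENNReal.ofReal_lt_top)]
  have hpdf : ∀ x : ℝ, (cauchyPDF 0 1 x).toReal • f x =
      (Real.pi : ℂ)⁻¹ * (|1 / (1 + x ^ 2)| • f x) := fun x => by
    have h1 : (0 : ℝ) < 1 + x ^ 2 := by positivity
    rw [cauchyPDF_def, ENNReal.toReal_ofReal (cauchyPDF_pos 0 one_ne_zero x).le,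
      cauchyPDFReal_def, abs_of_pos (by positivity), Complex.real_smul, Complex.real_smul]
    push_cast
    simp [add_comm]
    ring
  calc _ = ∫ x : ℝ, (cauchyPDF 0 1 x).toReal • f x := rfl
    _ = ∫ x : ℝ, (Real.pi : ℂ)⁻¹ * (|1 / (1 + x ^ 2)| • f x) := by simp only [hpdf]
    _ = Complex.exp (-t) := by
      rw [integral_const_mul, hval, inv_mul_cancel_left₀ hpi]

theorem map_ratio_of_rotation_invariant {m : ℕ} {μ : Measure ((Fin m → ℝ) × (Fin m → ℝ))}
    [IsProbabilityMeasure μ] (hac : μ ≪ volume)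
    (hrot : ∀ θ, MeasurePreserving (planeRotation θ) μ μ) {w : Fin m → ℝ} (hw : ∀ j, 0 ≤ w j)
    (hw1 : ∑ j, w j = 1) :
    μ.map (fun p => ∑ j, w j * (p.1 j / p.2 j)) = cauchyMeasure 0 1 := by
  have hm : Measurable fun p : (Fin m → ℝ) × (Fin m → ℝ) => ∑ j, w j * (p.1 j / p.2 j) := by
    fun_prop
  have := Measure.isProbabilityMeasure_map (μ := μ) hm.aemeasurable
  have hneg : ∀ t : ℝ, 0 ≤ t → charFun (μ.map fun p => ∑ j, w j * (p.1 j / p.2 j)) (-t) =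
      charFun (cauchyMeasure 0 1) (-t) := fun t ht => by
    rw [charFun_ratio_of_rotation_invariant hac hrot hw hw1 ht, charFun_cauchyMeasure_neg ht]
  refine Measure.ext_of_charFun (funext fun t => ?_)
  rcases le_total 0 t with ht | ht
  · have h := hneg t ht
    rw [charFun_neg, charFun_neg] at h
    exact (starRingEnd ℂ).injective h
  · simpa using hneg (-t) (neg_nonneg.2 ht)

theorem theorem1 {Ω : Type*} [MeasurableSpace Ω] (P : Measure Ω) [IsProbabilityMeasure P]
    (m n : ℕ) (hm : 1 < m)
    (X Y : Ω → Fin m → ℝ)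
    (F : Fin n → Matrix (Fin m ⊕ Fin m) (Fin m ⊕ Fin m) ℝ)
    (hF : ∀ i, IsSymmAntisymmBlock (F i))
    (h : Fin n → ℝ → ℝ) (h_meas : ∀ i, Measurable (h i)) (h_nonneg : ∀ i t, 0 ≤ h i t)
    (K : ℝ)
    (hXY : HasLaw (fun ω => (X ω, Y ω))
      ((volume : Measure ((Fin m → ℝ) × (Fin m → ℝ))).withDensity
        (fun p => ENNReal.ofReal (K * ∏ i, h i (blockQuadForm (F i) p)))) P) :
    (∀ w : Fin m → ℝ, (∀ j, 0 ≤ w j) → ∑ j, w j = 1 →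
      HasLaw (fun ω => ∑ j, w j * (X ω j / Y ω j)) (cauchyMeasure 0 1) P) ∧
    (∀ j, HasLaw (fun ω => X ω j / Y ω j) (cauchyMeasure 0 1) P) := by
  have hdens : Measurable fun p : (Fin m → ℝ) × (Fin m → ℝ) =>
      ENNReal.ofReal (K * ∏ i, h i (blockQuadForm (F i) p)) := by
    refine ENNReal.measurable_ofReal.comp (measurable_const.mul ?_)
    exact Finset.measurable_fun_prod _ fun i _ =>
      (h_meas i).comp (continuous_blockQuadForm (F i)).measurable
  have hprob := hXY.isProbabilityMeasure_iff.1 ‹_›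
  have hrot : ∀ θ, MeasurePreserving (planeRotation (m := m) θ) _ _ := fun θ =>
    (measurePreserving_planeRotation θ).withDensity_of_comp_eq hdens
      fun p => by simp only [blockQuadForm_planeRotation (hF _)]
  have hmain : ∀ w : Fin m → ℝ, (∀ j, 0 ≤ w j) → ∑ j, w j = 1 →
      HasLaw (fun ω => ∑ j, w j * (X ω j / Y ω j)) (cauchyMeasure 0 1) P := fun w hw hw1 => by
    have hlaw : HasLaw (fun p : (Fin m → ℝ) × (Fin m → ℝ) => ∑ j, w j * (p.1 j / p.2 j))
        (cauchyMeasure 0 1) _ :=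
      ⟨by fun_prop, map_ratio_of_rotation_invariant
        (withDensity_absolutelyContinuous _ _) hrot hw hw1⟩
    exact hlaw.fun_comp hXY
  refine ⟨hmain, fun j => ?_⟩
  -- A single ratio is the case of all weight on `j`.
  have hj := hmain (Pi.single j 1) (fun i => by
    rcases eq_or_ne i j with rfl | hij
    · simp
    · simp [hij]) (by simp)
  simpa [Pi.single_apply] using hj
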